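/- All groups are finite. A colored group $(G,\gamma)$ is a finite group $G$ with a map $\gamma:G\to\mathcal C$ to a set of colors; an uncolored group carries the constant coloring. For $k\ge 2$, the $k$-dimensional Weisfeiler--Leman algorithm colors the $k$-tuples of elements of colored groups as follows. In Version I ($k$-WL$_{\mathrm I}$), tuples $\bar g\in G^k$ and $\bar h\in H^k$ (with $G=H$ allowed) get the same initial color iff $\gamma_G(g_i)=\gamma_H(h_i)$, $g_i=g_j\Leftrightarrow h_i=h_j$ and $g_ig_j=g_m\Leftrightarrow h_ih_j=h_m$ for all $1\le i,j,m\le k$. In Version II ($k$-WL$_{\mathrm{II}}$), they get the same initial color iff there is a color-preserving isomorphism $\varphi:\langle\bar g\rangle\to\langle\bar h\rangle$ with $\varphi(g_i)=h_i$ for all $i$. In both versions, with $\bar g_{j\leftarrow x}$ the tuple $\bar g$ with $j$-th entry replaced by $x$, $$\chi_{i+1}(\bar g)=\bigl(\chi_i(\bar g),\{\!\{(\chi_i(\bar g_{1\leftarrow x}),\dots,\chi_i(\bar g_{k\leftarrow x}))\mid x\in G\}\!\}\bigr).$$ Tuples have the same stable color iff $\chi_i$ agrees on them for every $i$. The color of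 an element $x\in G$ is the stable color of $(x,1,\dots,1)\in G^k$. Two colored groups $G,H$ are not distinguished by $k$-WL$_J$, written $G\equiv^J_k H$, if there is a bijection $G^k\to H^k$ preserving stable colors. A map $\mathcal S$ assigning to each colored group $(G,\gamma)$ a subset $\mathcal S(G,\gamma)\subseteq G$ is $k$-WL$_J$-detectable if, for all colored groups $(G,\gamma_G),(H,\gamma_H)$, no element of $\mathcal S(G,\gamma_G)$ has the same ($k$-WL$_J$) color as an element of $H\setminus\mathcal S(H,\gamma_H)$. Theorem. (1) The assignment $(G,\gamma)\mapsto Z(G)$ of the center is $2$-WL$_{\mathrm{II}}$-detectable. (2) For $g\in G$ let $\kappa_g(h)=ghg^{-1}$, and let $\mathrm{Inn}(G)=\{\kappa_g\mid g\in G\}\le\mathrm{Aut}(G)$. For every finite group $G$, the rule $gZ(G)\mapsto\kappa_g$ is a well-defined group isomorphism $G/Z(G)\cong\mathrm{Inn}(G)$. (3) For every $k\ge 4$ and all (uncolored) finite groups $G,H$: if $G\equiv^{\mathrm I}_k H$, then $\mathrm{Inn}(G)\equiv^{\mathrm I}_k\mathrm{Inn}(H)$. -/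

import Mathlib

universe u v

/-- A finite group together with an element-coloring with colors in `C`. -/
structure ColoredGroup (C : Type v) where
  carrier : Type u
  [group : Group carrier]
  [finite : Finite carrier]
  color : carrier → C

namespace ColoredGroup

instance {C : Type v} (A : ColoredGroup.{u, v} C) : Group A.carrier := A.group

instance {C : Type v} (A : ColoredGroup.{u, v} C) : Finite A.carrier := A.finite

/-- An (uncolored) finite group, viewed as a colored group with a single color. -/
def uncolored (G : Type u) [Group G] [Finite G] : ColoredGroup.{u, 0} Unit where
  carrier := G
  color := fun _ => ()

end ColoredGroup

/-- The two versions of the Weisfeiler-Leman algorithm on colored groups. -/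
inductive WLVersion where
  | I
  | II

namespace WL

/-- A colored group together with a `k`-tuple of its elements. -/
structure MarkedGroup (k : ℕ) (C : Type v) where
  toColoredGroup : ColoredGroup.{u, v} C
  tuple : Fin k → toColoredGroup.carrier

/-- Version I: two tuples get the same initial color iff they agree in the colors of their entries,
in the equalities among the entries and in the multiplication relation among the entries. -/
def SameInitialI {k : ℕ} {C : Type v} (p q : MarkedGroup.{u, v} k C) : Prop :=
  (∀ i, p.toColoredGroup.color (p.tuple i) = q.toColoredGroup.color (q.tuple i)) ∧
  (∀ i j, p.tuple i = p.tuple j ↔ q.tuple i = q.tuple j) ∧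
  (∀ i j m, p.tuple i * p.tuple j = p.tuple m ↔ q.tuple i * q.tuple j = q.tuple m)

/-- Version II: two tuples get the same initial color iff there is a color-preserving isomorphism
between the subgroups they generate, mapping the first tuple entrywise to the second. -/
def SameInitialII {k : ℕ} {C : Type v} (p q : MarkedGroup.{u, v} k C) : Prop :=
  ∃ φ : Subgroup.closure (Set.range p.tuple) ≃* Subgroup.closure (Set.range q.tuple),
    (∀ i, (φ ⟨p.tuple i, Subgroup.subset_closure ⟨i, rfl⟩⟩ : q.toColoredGroup.carrier)
      = q.tuple i) ∧
    ∀ x, q.toColoredGroup.color (φ x) = p.toColoredGroup.color x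

/-- Equality of initial colors. -/
def SameInitial (J : WLVersion) {k : ℕ} {C : Type v} (p q : MarkedGroup.{u, v} k C) : Prop :=
  match J with
  | .I => SameInitialI p q
  | .II => SameInitialII p q

theorem sameInitialI_equivalence (k : ℕ) (C : Type v) :
    Equivalence (SameInitialI (k := k) (C := C) : MarkedGroup.{u, v} k C → _ → Prop) where
  refl _ := ⟨fun _ => rfl, fun _ _ => Iff.rfl, fun _ _ _ => Iff.rfl⟩
  symm h := ⟨fun i => (h.1 i).symm, fun i j => (h.2.1 i j).symm, fun i j m => (h.2.2 i j m).symm⟩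
  trans h h' := ⟨fun i => (h.1 i).trans (h'.1 i), fun i j => (h.2.1 i j).trans (h'.2.1 i j),
    fun i j m => (h.2.2 i j m).trans (h'.2.2 i j m)⟩

theorem sameInitialII_equivalence (k : ℕ) (C : Type v) :
    Equivalence (SameInitialII (k := k) (C := C) : MarkedGroup.{u, v} k C → _ → Prop) where
  refl _ := ⟨MulEquiv.refl _, fun _ => rfl, fun _ => rfl⟩
  symm := by
    rintro p q ⟨φ, h1, h2⟩
    refine ⟨φ.symm, fun i => ?_, fun x => ?_⟩
    · have : φ ⟨p.tuple i, Subgroup.subset_closure ⟨i, rfl⟩⟩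
          = ⟨q.tuple i, Subgroup.subset_closure ⟨i, rfl⟩⟩ := Subtype.ext (h1 i)
      rw [← this, MulEquiv.symm_apply_apply]
    · rw [← h2 (φ.symm x), MulEquiv.apply_symm_apply]
  trans := by
    rintro p q r ⟨φ, h1, h2⟩ ⟨ψ, h3, h4⟩
    refine ⟨φ.trans ψ, fun i => ?_, fun x => ?_⟩
    · have : φ ⟨p.tuple i, Subgroup.subset_closure ⟨i, rfl⟩⟩
          = ⟨q.tuple i, Subgroup.subset_closure ⟨i, rfl⟩⟩ := Subtype.ext (h1 i)
      rw [MulEquiv.trans_apply, this, h3]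
    · rw [MulEquiv.trans_apply, h4, h2]

/-- The equivalence relation "same initial color" on tuples in arbitrary colored groups. -/
def initialSetoid (J : WLVersion) (k : ℕ) (C : Type v) : Setoid (MarkedGroup.{u, v} k C) where
  r := SameInitial J
  iseqv := match J with
    | .I => sameInitialI_equivalence k C
    | .II => sameInitialII_equivalence k C

/-- The colors used in the `i`-th round of `k`-WL. -/
def RoundColors (J : WLVersion) (k : ℕ) (C : Type v) : ℕ → Type (max (u + 1) v)
  | 0 => Quotient (initialSetoid.{u, v} J k C)
  | i + 1 => RoundColors J k C i × Multiset (Fin k → RoundColors J k C i)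

/-- All elements of a finite type, as a multiset without repetitions. -/
noncomputable def allElements (α : Type u) [Finite α] : Multiset α :=
  (@Finset.univ α (Fintype.ofFinite α)).val

/-- The coloring of `k`-tuples after `i` rounds of refinement: a new color consists of the old color
of the tuple `g` and of the multiset, over all group elements `x`, of the `k`-tuples of old colors
of the tuples obtained from `g` by replacing the `j`-th entry by `x`, for `j = 1, …, k`. -/
noncomputable def roundColor (J : WLVersion) (k : ℕ) {C : Type v} (A : ColoredGroup.{u, v} C) :
    (i : ℕ) → (Fin k → A.carrier) → RoundColors.{u, v} J k C i
  | 0, g => Quotient.mk (initialSetoid J k C) ⟨A, g⟩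
  | i + 1, g =>
    (roundColor J k A i g,
      (allElements A.carrier).map fun x j => roundColor J k A i (Function.update g j x))

/-- The stable color of a `k`-tuple, recorded as the sequence of its colors in all rounds. On one
group this induces the partition at which the refinement stabilizes; tuples of two groups get the
same stable color iff their colors agree in every round (of the refinement run in parallel). -/
noncomputable def stableColor (J : WLVersion) (k : ℕ) {C : Type v} (A : ColoredGroup.{u, v} C)
    (g : Fin k → A.carrier) : (i : ℕ) → RoundColors.{u, v} J k C i :=
  fun i => roundColor J k A i g

/-- The induced coloring of group elements: the stable color of `(x, 1, …, 1)`. -/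
noncomputable def elementColor (J : WLVersion) (k : ℕ) {C : Type v} (A : ColoredGroup.{u, v} C)
    (x : A.carrier) : (i : ℕ) → RoundColors.{u, v} J k C i :=
  stableColor J k A fun j => if (j : ℕ) = 0 then x else 1

/-- `A` and `B` are not distinguished by `k`-WL of version `J`: there is a bijection between their
`k`-tuples preserving stable colors. -/
def Indistinguishable (J : WLVersion) (k : ℕ) {C : Type v} (A B : ColoredGroup.{u, v} C) : Prop :=
  ∃ f : (Fin k → A.carrier) ≃ (Fin k → B.carrier),
    ∀ g, stableColor J k A g = stableColor J k B (f g)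

/-- A subset selector associates a subset with every colored group. -/
def SubsetSelector : Type _ :=
  ∀ (C : Type v) (A : ColoredGroup.{u, v} C), Set A.carrier

/-- `S` is detectable by `k`-WL of version `J`: no element selected by `S` in some colored group has
the same color as an element not selected by `S` in another (or the same) colored group. -/
def IsDetectable (J : WLVersion) (k : ℕ) (S : SubsetSelector.{u, v}) : Prop :=
  ∀ (C : Type v) (A B : ColoredGroup.{u, v} C),
    (elementColor J k A '' S C A) ∩ (elementColor J k B '' (S C B)ᶜ) = ∅

/-- The subset selector that associates with every colored group its center. -/
def centerSelector : SubsetSelector.{u, v} :=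
  fun _ A => (Subgroup.center A.carrier : Set A.carrier)

/-- The inner automorphism group of `G`: all automorphisms `h ↦ g * h * g⁻¹` with `g` in `G`. -/
def Inn (G : Type u) [Group G] : Subgroup (MulAut G) :=
  (MulAut.conj : G →* MulAut G).range

end WL

/-! Equal stable colors amount to a bijective pebble game: one bijection of the groups answers every
replacement of an entry (`exists_equiv_of_stableColor_eq`). For the center in Version II, put an
arbitrary element beside the tested one: an isomorphism of the generated subgroups preserves
commutation. The isomorphism with the inner automorphism group is the first isomorphism theorem for
conjugation.

For the last claim, stable colors on `G` determine which relations `g i * g j = g m` hold modulo the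
center (`mul_inv_mul_mem_center_of_stableColor_eq`). So "having lifts of equal stable color" refines
the initial coloring on the inner automorphism groups. Hall's marriage theorem
(`exists_equiv_of_surjective`) lets bijections descend to these quotients, so the relation is also
closed under the game. -/

/-! ### Bijections and surjective homomorphisms -/

/-- Two functions on finite types with the same multiset of values differ by a bijection. -/
theorem exists_equiv_of_map_allElements_eq {α : Type*} {β : Type*} {γ : Type*} [Finite α]
    [Finite β] {F : α → γ} {F' : β → γ}
    (h : (WL.allElements α).map F = (WL.allElements β).map F') :
    ∃ f : α ≃ β, ∀ x, F x = F' (f x) := by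
  classical
  let := Fintype.ofFinite α
  let := Fintype.ofFinite β
  have hcard (c : γ) : Fintype.card {a // F a = c} = Fintype.card {b // F' b = c} := by
    have := congrArg (Multiset.count c) h
    simp only [WL.allElements, Multiset.count_map] at this
    rw [Fintype.card_subtype, Fintype.card_subtype]
    simpa only [Finset.card_def, Finset.filter_val, eq_comm] using this
  refine ⟨Equiv.ofFiberEquiv fun c => Fintype.equivOfCardEq (hcard c), fun x => ?_⟩
  exact (Equiv.ofFiberEquiv_map _ x).symm

theorem map_allElements_eq_of_equiv {α : Type*} {β : Type*} {γ : Type*} [Finite α] [Finite β]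
    {F : α → γ} {F' : β → γ} (f : α ≃ β) (h : ∀ x, F x = F' (f x)) :
    (WL.allElements α).map F = (WL.allElements β).map F' := by
  let := Fintype.ofFinite α
  let := Fintype.ofFinite β
  have : WL.allElements β = (WL.allElements α).map f := (Multiset.map_univ_val_equiv f).symm
  rw [this, Multiset.map_map]
  exact Multiset.map_congr rfl fun x _ => h x

/-- All fibers of `π` are equally large; clearing denominators avoids division. -/
theorem card_mul_card_eq_of_surjective {X A : Type*} [Group X] [Group A] [Fintype X] [Fintype A]
    [DecidableEq A] {π : X →* A} (hπ : Function.Surjective π) (s : Finset A) :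
    Fintype.card X * s.card
      = Fintype.card A * (Finset.univ.filter fun x => π x ∈ s).card := by
  have hf (a : A) : (Finset.univ.filter fun x => π x = a).card
      = (Finset.univ.filter fun x => π x = 1).card :=
    MonoidHom.card_fiber_eq_of_mem_range π (hπ a) (hπ 1)
  have h (t : Finset A) : (Finset.univ.filter fun x => π x ∈ t).card
      = t.card * (Finset.univ.filter fun x => π x = 1).card := by
    rw [Finset.card_eq_sum_card_fiberwise (f := π) (t := t) (fun x hx => by simpa using hx),
      ← smul_eq_mul, ← Finset.sum_const]
    refine Finset.sum_congr rfl fun a ha => ?_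
    rw [← hf a, Finset.filter_filter]
    congr 1
    ext x
    simp only [Finset.mem_filter, Finset.mem_univ, true_and]
    exact ⟨fun h => h.2, fun h => ⟨h ▸ ha, h⟩⟩
  have huniv := h Finset.univ
  simp only [Finset.mem_univ, Finset.filter_true, Finset.card_univ] at huniv
  rw [h s, huniv]
  ring

/-- A bijection between finite groups can be pushed forward along surjective homomorphisms onto
groups of equal order, up to the choice of preimages. -/
theorem exists_equiv_of_surjective {X Y A B : Type*} [Group X] [Group Y] [Group A] [Group B]
    [Finite X] [Finite Y] {π : X →* A} {ρ : Y →* B} (hπ : Function.Surjective π)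
    (hρ : Function.Surjective ρ) (hAB : Nat.card A = Nat.card B) (f : X ≃ Y) :
    ∃ F : A ≃ B, ∀ a, ∃ x, π x = a ∧ ρ (f x) = F a := by
  classical
  let := Fintype.ofFinite X
  let := Fintype.ofFinite Y
  have := Finite.of_surjective π hπ
  have := Finite.of_surjective ρ hρ
  let := Fintype.ofFinite A
  let := Fintype.ofFinite B
  rw [Nat.card_eq_fintype_card, Nat.card_eq_fintype_card] at hAB
  let t (a : A) : Finset B := (Finset.univ.filter fun x => π x = a).image fun x => ρ (f x)
  -- Hall's condition: `f` embeds the preimage of `s` into the preimage of its neighbors, and the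
  -- fibers of `π` and `ρ` have the same size.
  obtain ⟨F, hF, hFt⟩ := (Finset.all_card_le_biUnion_card_iff_exists_injective t).1 fun s => by
    have h1 : (Finset.univ.filter fun x => π x ∈ s).card
        ≤ (Finset.univ.filter fun y => ρ y ∈ s.biUnion t).card := by
      refine Finset.card_le_card_of_injOn f (fun x hx => ?_) f.injective.injOn
      simp only [Finset.coe_filter, Finset.mem_univ, true_and, Set.mem_ofPred_eq] at hx
      simp only [Finset.coe_filter, Finset.mem_univ, true_and, Set.mem_ofPred_eq, t,
        Finset.mem_biUnion, Finset.mem_image, Finset.mem_filter]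
      exact ⟨π x, hx, x, rfl, rfl⟩
    have h2 := card_mul_card_eq_of_surjective hπ s
    have h3 := card_mul_card_eq_of_surjective hρ (s.biUnion t)
    rw [← hAB, ← Fintype.card_congr f] at h3
    refine Nat.le_of_mul_le_mul_left ?_ (Fintype.card_pos (α := X))
    rw [h2, h3]
    exact Nat.mul_le_mul_left _ h1
  refine ⟨Equiv.ofBijective F ((Fintype.bijective_iff_injective_and_card F).2 ⟨hF, hAB⟩),
    fun a => ?_⟩
  have := hFt a
  simpa [t] using this

namespace WL

/-! ### Stable colors and the bijective pebble game -/

theorem roundColor_eq_of_le {J : WLVersion} {k : ℕ} {C : Type v} {A B : ColoredGroup.{u, v} C}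
    {g : Fin k → A.carrier} {h : Fin k → B.carrier} {m n : ℕ} (hmn : m ≤ n)
    (e : roundColor J k A n g = roundColor J k B n h) :
    roundColor J k A m g = roundColor J k B m h := by
  induction n, hmn using Nat.le_induction with
  | base => exact e
  | succ n _ ih => exact ih (congrArg Prod.fst e)

theorem exists_equiv_of_roundColor_succ_eq {J : WLVersion} {k : ℕ} {C : Type v}
    {A B : ColoredGroup.{u, v} C} {g : Fin k → A.carrier} {h : Fin k → B.carrier} {n : ℕ}
    (e : roundColor J k A (n + 1) g = roundColor J k B (n + 1) h) :
    ∃ f : A.carrier ≃ B.carrier, ∀ x j,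
      roundColor J k A n (Function.update g j x) = roundColor J k B n (Function.update h j (f x)) := by
  obtain ⟨f, hf⟩ := exists_equiv_of_map_allElements_eq (congrArg Prod.snd e)
  exact ⟨f, fun x j => congrFun (hf x) j⟩

theorem sameInitial_of_roundColor_zero_eq {J : WLVersion} {k : ℕ} {C : Type v}
    {A B : ColoredGroup.{u, v} C} {g : Fin k → A.carrier} {h : Fin k → B.carrier}
    (e : roundColor J k A 0 g = roundColor J k B 0 h) : SameInitial J ⟨A, g⟩ ⟨B, h⟩ :=
  Quotient.exact e

/-- Tuples of the same stable color admit a single bijection answering every replacement of an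
entry by a tuple of the same stable color. -/
theorem exists_equiv_of_stableColor_eq {J : WLVersion} {k : ℕ} {C : Type v}
    {A B : ColoredGroup.{u, v} C} {g : Fin k → A.carrier} {h : Fin k → B.carrier}
    (e : stableColor J k A g = stableColor J k B h) :
    ∃ f : A.carrier ≃ B.carrier, ∀ x j, stableColor J k A (Function.update g j x)
      = stableColor J k B (Function.update h j (f x)) := by
  choose f hf using fun n => exists_equiv_of_roundColor_succ_eq (congrFun e (n + 1))
  -- There are finitely many bijections, so one of them works for arbitrarily late rounds, hence for
  -- all.
  obtain ⟨f₀, hf₀⟩ := Finite.exists_infinite_fiber f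
  refine ⟨f₀, fun x j => funext fun n => ?_⟩
  obtain ⟨m, hm, hnm⟩ := (Set.infinite_coe_iff.1 hf₀).exists_gt n
  have := hf m x j
  rw [show f m = f₀ from hm] at this
  exact roundColor_eq_of_le hnm.le this

/-- Related tuples have the same stable color if the relation refines equality of initial colors
and is closed under the bijective pebble game. -/
theorem stableColor_eq_of_bisimulation {J : WLVersion} {k : ℕ} {C : Type v}
    {A B : ColoredGroup.{u, v} C} {R : (Fin k → A.carrier) → (Fin k → B.carrier) → Prop}
    (h0 : ∀ g h, R g h → SameInitial J ⟨A, g⟩ ⟨B, h⟩)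
    (hstep : ∀ g h, R g h → ∃ f : A.carrier ≃ B.carrier, ∀ x j,
      R (Function.update g j x) (Function.update h j (f x)))
    {g : Fin k → A.carrier} {h : Fin k → B.carrier} (hR : R g h) :
    stableColor J k A g = stableColor J k B h := by
  funext n
  change roundColor J k A n g = roundColor J k B n h
  induction n generalizing g h with
  | zero => exact Quotient.sound (h0 g h hR)
  | succ n ih =>
    obtain ⟨f, hf⟩ := hstep g h hR
    exact Prod.ext (ih hR) (map_allElements_eq_of_equiv f fun x => funext fun j => ih (hf x j))

theorem sameInitialI_of_stableColor_eq {k : ℕ} {C : Type v} {A B : ColoredGroup.{u, v} C}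
    {g : Fin k → A.carrier} {h : Fin k → B.carrier}
    (e : stableColor .I k A g = stableColor .I k B h) : SameInitialI ⟨A, g⟩ ⟨B, h⟩ :=
  sameInitial_of_roundColor_zero_eq (congrFun e 0)

theorem mul_eq_of_stableColor_eq {k : ℕ} {C : Type v} {A B : ColoredGroup.{u, v} C}
    {g : Fin k → A.carrier} {h : Fin k → B.carrier}
    (e : stableColor .I k A g = stableColor .I k B h) {i j m : Fin k} (hg : g i * g j = g m) :
    h i * h j = h m :=
  ((sameInitialI_of_stableColor_eq e).2.2 i j m).1 hg

/-! ### Relations modulo the center -/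

theorem exists_ne_three {k : ℕ} (hk : 4 ≤ k) (a b c : Fin k) : ∃ d, d ≠ a ∧ d ≠ b ∧ d ≠ c := by
  have : ({a, b, c} : Finset (Fin k)).card < Fintype.card (Fin k) := by
    rw [Fintype.card_fin]
    exact lt_of_le_of_lt Finset.card_le_three hk
  obtain ⟨d, hd⟩ := Finset.exists_mem_notMem_of_card_lt_card (s := {a, b, c}) (t := Finset.univ) this
  exact ⟨d, by simpa using hd.2⟩

/-- Place `x` and `x * g i` in two spare positions; both products of `x` and `g i` are then visible
to the initial color. -/
theorem mem_center_of_stableColor_eq {k : ℕ} (hk : 3 ≤ k) {C : Type v} {A B : ColoredGroup.{u, v} C}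
    {g : Fin k → A.carrier} {h : Fin k → B.carrier}
    (e : stableColor .I k A g = stableColor .I k B h) {i : Fin k}
    (hg : g i ∈ Subgroup.center A.carrier) : h i ∈ Subgroup.center B.carrier := by
  obtain ⟨p, q, hpi, hqi, hpq⟩ : ∃ p q : Fin k, p ≠ i ∧ q ≠ i ∧ p ≠ q := by
    obtain ⟨p, hp⟩ := Finset.exists_mem_notMem_of_card_lt_card
      (s := {i}) (t := (Finset.univ : Finset (Fin k))) (by simp; omega)
    obtain ⟨q, hq⟩ := Finset.exists_mem_notMem_of_card_lt_card
      (s := {i, p}) (t := (Finset.univ : Finset (Fin k)))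
      (lt_of_le_of_lt Finset.card_le_two (by simp; omega))
    simp only [Finset.mem_insert, Finset.mem_singleton, not_or] at hp hq
    exact ⟨p, q, hp.2, hq.2.1, Ne.symm hq.2.2⟩
  obtain ⟨f, hf⟩ := exists_equiv_of_stableColor_eq e
  rw [Subgroup.mem_center_iff]
  intro y
  obtain ⟨x, rfl⟩ := f.surjective y
  obtain ⟨f', hf'⟩ := exists_equiv_of_stableColor_eq (hf x p)
  have h2 := hf' (x * g i) q
  have h3 := mul_eq_of_stableColor_eq h2 (i := p) (j := i) (m := q)
  have h4 := mul_eq_of_stableColor_eq h2 (i := i) (j := p) (m := q)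
  simp only [Function.update_self, Function.update_of_ne hpi.symm, Function.update_of_ne hqi.symm,
    Function.update_of_ne hpq, true_implies] at h3 h4
  rw [h3, h4 ((Subgroup.mem_center_iff.1 hg x).symm)]

theorem inv_mul_mem_center_of_stableColor_eq {k : ℕ} (hk : 3 ≤ k) {C : Type v}
    {A B : ColoredGroup.{u, v} C} {g : Fin k → A.carrier} {h : Fin k → B.carrier}
    (e : stableColor .I k A g = stableColor .I k B h) {i j l : Fin k} (hi : l ≠ i) (hj : l ≠ j)
    (hg : (g i)⁻¹ * g j ∈ Subgroup.center A.carrier) :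
    (h i)⁻¹ * h j ∈ Subgroup.center B.carrier := by
  obtain ⟨f, hf⟩ := exists_equiv_of_stableColor_eq e
  have h1 := hf ((g i)⁻¹ * g j) l
  have h2 := mem_center_of_stableColor_eq hk h1 (i := l) (by simpa using hg)
  have h3 := mul_eq_of_stableColor_eq h1 (i := i) (j := l) (m := j)
  simp only [Function.update_self, Function.update_of_ne hi.symm, Function.update_of_ne hj.symm,
    mul_inv_cancel_left, true_implies] at h2 h3
  rwa [← h3, inv_mul_cancel_left]

theorem mul_inv_mul_mem_center_of_stableColor_eq {k : ℕ} (hk : 4 ≤ k) {C : Type v}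
    {A B : ColoredGroup.{u, v} C} {g : Fin k → A.carrier} {h : Fin k → B.carrier}
    (e : stableColor .I k A g = stableColor .I k B h) {i j m : Fin k}
    (hg : (g i * g j)⁻¹ * g m ∈ Subgroup.center A.carrier) :
    (h i * h j)⁻¹ * h m ∈ Subgroup.center B.carrier := by
  obtain ⟨l, hi, hj, hm⟩ := exists_ne_three hk i j m
  -- Once `l` holds the product, positions `i` and `j` may be overwritten, so `p` need not avoid
  -- them.
  obtain ⟨p, hpl, hpm, -⟩ := exists_ne_three hk l m m
  obtain ⟨f, hf⟩ := exists_equiv_of_stableColor_eq e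
  have h1 := hf (g i * g j) l
  have h2 := mul_eq_of_stableColor_eq h1 (i := i) (j := j) (m := l)
  have h3 := inv_mul_mem_center_of_stableColor_eq (by omega) h1 (i := l) (j := m) hpl hpm
  simp only [Function.update_self, Function.update_of_ne hi.symm, Function.update_of_ne hj.symm,
    Function.update_of_ne hm.symm, true_implies] at h2 h3
  rw [h2]
  exact h3 hg

theorem card_center_le_of_stableColor_one_eq {k : ℕ} (hk : 3 ≤ k) {C : Type v}
    {A B : ColoredGroup.{u, v} C}
    (e : stableColor .I k A (1 : Fin k → A.carrier) = stableColor .I k B (1 : Fin k → B.carrier)) :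
    Nat.card (Subgroup.center A.carrier) ≤ Nat.card (Subgroup.center B.carrier) := by
  obtain ⟨f, hf⟩ := exists_equiv_of_stableColor_eq e
  have hmem (x : A.carrier) (hx : x ∈ Subgroup.center A.carrier) :
      f x ∈ Subgroup.center B.carrier := by
    simpa using mem_center_of_stableColor_eq hk (hf x ⟨0, by omega⟩) (i := ⟨0, by omega⟩)
      (by simpa using hx)
  exact Nat.card_le_card_of_injective
    (fun x : Subgroup.center A.carrier => (⟨f x, hmem x x.2⟩ : Subgroup.center B.carrier))
    fun x y hxy => Subtype.ext (f.injective (congrArg Subtype.val hxy))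

theorem card_center_eq_of_stableColor_eq {k : ℕ} (hk : 3 ≤ k) {C : Type v}
    {A B : ColoredGroup.{u, v} C} {h : Fin k → B.carrier}
    (e : stableColor .I k A (1 : Fin k → A.carrier) = stableColor .I k B h) :
    Nat.card (Subgroup.center A.carrier) = Nat.card (Subgroup.center B.carrier) := by
  -- The relation `1 * 1 = 1` forces every entry of `h` to be trivial.
  obtain rfl : h = 1 := funext fun i =>
    mul_eq_left.1 (mul_eq_of_stableColor_eq e (i := i) (j := i) (m := i) (mul_one 1))
  exact le_antisymm (card_center_le_of_stableColor_one_eq hk e)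
    (card_center_le_of_stableColor_one_eq hk e.symm)

/-! ### Inner automorphisms and the three claims -/

theorem ker_conj (G : Type u) [Group G] :
    (MulAut.conj : G →* MulAut G).ker = Subgroup.center G := by
  ext g
  rw [MonoidHom.mem_ker, Subgroup.mem_center_iff, MulEquiv.ext_iff]
  refine forall_congr' fun x => ?_
  rw [MulAut.conj_apply, MulAut.one_apply, mul_inv_eq_iff_eq_mul, eq_comm]

/-- The homomorphism sending an element to its inner automorphism. -/
def toInn (G : Type u) [Group G] : G →* Inn G := (MulAut.conj : G →* MulAut G).rangeRestrict

theorem toInn_surjective (G : Type u) [Group G] : Function.Surjective (toInn G) :=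
  MonoidHom.rangeRestrict_surjective _

theorem toInn_eq_iff {G : Type u} [Group G] {a b : G} :
    toInn G a = toInn G b ↔ a⁻¹ * b ∈ Subgroup.center G := by
  rw [← ker_conj, ← MonoidHom.ker_rangeRestrict, ← MonoidHom.eq_iff]
  exact eq_comm

theorem card_inn_mul_card_center (G : Type u) [Group G] :
    Nat.card (Inn G) * Nat.card (Subgroup.center G) = Nat.card G := by
  rw [← ker_conj, Inn, ← Subgroup.index_ker, Subgroup.index_mul_card]

theorem isDetectable_center : IsDetectable .II 2 centerSelector.{u, v} := by
  rintro C A B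
  refine Set.eq_empty_iff_forall_notMem.2 ?_
  rintro _ ⟨⟨x, hx, rfl⟩, y, hy, hxy⟩
  refine hy ?_
  obtain ⟨f, hf⟩ := exists_equiv_of_stableColor_eq (Eq.symm hxy)
  refine Subgroup.mem_center_iff.2 fun w => ?_
  obtain ⟨z, rfl⟩ := f.surjective w
  -- Writing `z` over the trivial second entry compares `(x, z)` with `(y, f z)`.
  obtain ⟨φ, h1, -⟩ : SameInitialII _ _ :=
    sameInitial_of_roundColor_zero_eq (congrFun (hf z 1) 0)
  have hx0 : (φ ⟨x, Subgroup.subset_closure ⟨0, rfl⟩⟩ : B.carrier) = y := h1 0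
  have hz1 : (φ ⟨z, Subgroup.subset_closure ⟨1, rfl⟩⟩ : B.carrier) = f z := h1 1
  refine (congrArg₂ (· * ·) hz1 hx0).symm.trans (Eq.trans ?_ (congrArg₂ (· * ·) hx0 hz1))
  simp only [← Subgroup.coe_mul, ← map_mul]
  exact congrArg (fun t => (φ t : B.carrier)) (Subtype.ext (Subgroup.mem_center_iff.1 hx z))

theorem exists_quotient_center_mulEquiv_inn (G : Type u) [Group G] :
    ∃ e : G ⧸ Subgroup.center G ≃* Inn G,
      ∀ g : G, (e (g : G ⧸ Subgroup.center G) : MulAut G) = MulAut.conj g :=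
  ⟨(QuotientGroup.quotientMulEquivOfEq (ker_conj G).symm).trans
    (QuotientGroup.quotientKerEquivRange MulAut.conj), fun _ => rfl⟩

theorem indistinguishable_inn {k : ℕ} (hk : 4 ≤ k) (G H : Type u) [Group G] [Finite G] [Group H]
    [Finite H] (hGH : Indistinguishable .I k (.uncolored G) (.uncolored H)) :
    Indistinguishable .I k (.uncolored (Inn G)) (.uncolored (Inn H)) := by
  obtain ⟨f, hf⟩ := hGH
  have hcard : Nat.card (Inn G) = Nat.card (Inn H) := by
    obtain ⟨f', -⟩ := exists_equiv_of_stableColor_eq (hf 1)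
    have h1 : Nat.card (Subgroup.center G) = Nat.card (Subgroup.center H) :=
      card_center_eq_of_stableColor_eq (by omega) (hf 1)
    have h2 : Nat.card G = Nat.card H := Nat.card_congr f'
    rw [← card_inn_mul_card_center G, ← card_inn_mul_card_center H, h1] at h2
    exact Nat.eq_of_mul_eq_mul_right Nat.card_pos h2
  let R (a : Fin k → Inn G) (b : Fin k → Inn H) : Prop := ∃ (g : Fin k → G) (h : Fin k → H),
    stableColor .I k (.uncolored G) g = stableColor .I k (.uncolored H) h ∧
      toInn G ∘ g = a ∧ toInn H ∘ h = b
  -- The groups are rebound so that this also applies to `e.symm`.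
  have hmul {G H : Type u} [Group G] [Group H] [Finite G] [Finite H] {g : Fin k → G}
      {h : Fin k → H} (e : stableColor .I k (.uncolored G) g = stableColor .I k (.uncolored H) h)
      (i j m : Fin k) (hm : toInn G (g i) * toInn G (g j) = toInn G (g m)) :
      toInn H (h i) * toInn H (h j) = toInn H (h m) := by
    rw [← map_mul, toInn_eq_iff] at hm ⊢
    exact mul_inv_mul_mem_center_of_stableColor_eq hk e hm
  have heq {G H : Type u} [Group G] [Group H] [Finite G] [Finite H] {g : Fin k → G}
      {h : Fin k → H} (e : stableColor .I k (.uncolored G) g = stableColor .I k (.uncolored H) h)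
      (i j : Fin k) (hm : toInn G (g i) = toInn G (g j)) : toInn H (h i) = toInn H (h j) := by
    rw [toInn_eq_iff] at hm ⊢
    obtain ⟨l, hi, hj, -⟩ := exists_ne_three hk i j j
    exact inv_mul_mem_center_of_stableColor_eq (by omega) e hi hj hm
  have hR {a b} (h : R a b) :
      stableColor .I k (.uncolored (Inn G)) a = stableColor .I k (.uncolored (Inn H)) b := by
    refine stableColor_eq_of_bisimulation (R := R) ?_ ?_ h
    · rintro _ _ ⟨g, h, e, rfl, rfl⟩
      exact ⟨fun _ => rfl, fun i j => ⟨heq e i j, heq e.symm i j⟩,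
        fun i j m => ⟨hmul e i j m, hmul e.symm i j m⟩⟩
    · rintro _ _ ⟨g, h, e, rfl, rfl⟩
      obtain ⟨f, hf⟩ := exists_equiv_of_stableColor_eq e
      obtain ⟨F, hF⟩ := exists_equiv_of_surjective (toInn_surjective G) (toInn_surjective H) hcard f
      refine ⟨F, fun x j => ?_⟩
      -- The lift `y` of `x` is chosen so that `f y` lifts `F x`.
      obtain ⟨y, rfl, hy⟩ := hF x
      exact ⟨_, _, hf y j, Function.comp_update _ _ _ _,
        (Function.comp_update _ _ _ _).trans (congrArg (Function.update _ j) hy)⟩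
  -- The same descent, now for the `k`-th direct powers.
  obtain ⟨F, hF⟩ := exists_equiv_of_surjective (π := (toInn G).compLeft (Fin k))
    (ρ := (toInn H).compLeft (Fin k)) (toInn_surjective G).comp_left (toInn_surjective H).comp_left
    (by simp [Nat.card_fun, hcard]) f
  refine ⟨F, fun a => ?_⟩
  obtain ⟨x, rfl, hx⟩ := hF a
  exact hR ⟨x, f x, hf x, rfl, hx⟩

end WL

theorem mainTheorem8 :
    WL.IsDetectable WLVersion.II 2 WL.centerSelector.{u, v} ∧
    (∀ (G : Type u) [Group G] [Finite G],
      ∃ e : G ⧸ Subgroup.center G ≃* WL.Inn G,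
        ∀ g : G, (e (g : G ⧸ Subgroup.center G) : MulAut G) = MulAut.conj g) ∧
    (∀ (k : ℕ), 4 ≤ k → ∀ (G H : Type u) [Group G] [Finite G] [Group H] [Finite H],
      WL.Indistinguishable WLVersion.I k (ColoredGroup.uncolored G) (ColoredGroup.uncolored H) →
      WL.Indistinguishable WLVersion.I k
        (ColoredGroup.uncolored (WL.Inn G)) (ColoredGroup.uncolored (WL.Inn H))) :=
  ⟨WL.isDetectable_center, fun G _ _ => WL.exists_quotient_center_mulEquiv_inn G,
    fun _ hk G H _ _ _ _ => WL.indistinguishable_inn hk G H⟩
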